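/- Let $n\ge 1$, $0<p<1$, let $A,Q\in\mathbb{C}^{n\times n}$ with $Q$ Hermitian positive definite, and let $\|\cdot\|$ denote the spectral norm and $\lambda_{\min}(M)$ the smallest eigenvalue of a Hermitian matrix $M$. Consider the equation $$X-A^*X^{-p}A=Q .$$ Let $\widetilde X\in\mathbb{C}^{n\times n}$ be Hermitian positive definite, and put $$R(\widetilde X)=Q+A^*\widetilde X^{-p}A-\widetilde X,\qquad \theta_1=\bigl(1-\|\widetilde X^{-p/2}A\|^2\,\|\widetilde X^{-1}\|\bigr)\lambda_{\min}(\widetilde X)+\|R(\widetilde X)\| .$$ Assume that $$\|\widetilde X^{-p/2}A\|^2\,\|\widetilde X^{-1}\|<1\qquad\text{and}\qquad \|R(\widetilde X)\|\le\frac{\theta_1}{2}\min\Bigl\{1,\frac{\theta_1}{2\lambda_{\min}(\widetilde X)}\Bigr\}.$$ Then the equation has exactly one Hermitian positive definite solution $X$, and this solution satisfies $$\|\widetilde X-X\|\le\theta\,\|R(\widetilde X)\|,\qquad\text{where}\qquad \theta=\frac{2\lambda_{\min}(\widetilde X)}{\theta_1+\sqrt{\theta_1^2-4\lambda_{\min}(\widetilde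 X)\|R(\widetilde X)\|}} .$$ -/

import Mathlib

open scoped Matrix ComplexOrder MatrixOrder Matrix.Norms.L2Operator

noncomputable section

namespace MatrixEq

/-- The minimal eigenvalue `λ_min(M)` of a Hermitian matrix: the least element of the
(finite) set of its real eigenvalues. -/
def lambdaMin {n : ℕ} (M : Matrix (Fin n) (Fin n) ℂ) : ℝ :=
  sInf (spectrum ℝ M)

/-- For a Hermitian matrix of positive size, `lambdaMin` is an eigenvalue, and it is the least. -/
theorem isLeast_lambdaMin {n : ℕ} [NeZero n] {M : Matrix (Fin n) (Fin n) ℂ}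
    (hM : M.IsHermitian) : IsLeast (Set.range hM.eigenvalues) (lambdaMin M) := by
  unfold lambdaMin
  rw [hM.spectrum_real_eq_range_eigenvalues]
  exact ⟨(Set.range_nonempty _).csInf_mem (Set.finite_range _),
    fun _ hx => csInf_le (Set.finite_range _).bddBelow hx⟩

/-- `X` is a positive definite solution of `X - A* X^{-p} A = Q`. Real powers of matrices are
those of the functional calculus. -/
def IsPosDefSolution {n : ℕ} (p : ℝ) (A Q X : Matrix (Fin n) (Fin n) ℂ) : Prop :=
  X.PosDef ∧ X - Aᴴ * X ^ (-p) * A = Q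

/-- The residual `R(Y) = Q + A* Y^{-p} A - Y`. -/
def residual {n : ℕ} (p : ℝ) (A Q Y : Matrix (Fin n) (Fin n) ℂ) : Matrix (Fin n) (Fin n) ℂ :=
  Q + Aᴴ * Y ^ (-p) * A - Y

/-- `θ₁ = (1 - ‖Y^{-p/2} A‖² ‖Y⁻¹‖) λ_min(Y) + ‖R(Y)‖`, with the spectral norm. -/
def theta₁ {n : ℕ} (p : ℝ) (A Q Y : Matrix (Fin n) (Fin n) ℂ) : ℝ :=
  (1 - ‖Y ^ (-(p / 2)) * A‖ ^ 2 * ‖Y⁻¹‖) * lambdaMin Y + ‖residual p A Q Y‖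

/-- `θ = 2 λ_min(Y) / (θ₁ + √(θ₁² - 4 λ_min(Y) ‖R(Y)‖))`. -/
def theta {n : ℕ} (p : ℝ) (A Q Y : Matrix (Fin n) (Fin n) ℂ) : ℝ :=
  2 * lambdaMin Y /
    (theta₁ p A Q Y +
      Real.sqrt (theta₁ p A Q Y ^ 2 - 4 * lambdaMin Y * ‖residual p A Q Y‖))

end MatrixEq

end

/-! ### Powers, order and fixed points in C*-algebras -/

namespace CStarAlgebra

open Set Filter Topology
open scoped NNReal

variable {𝓐 : Type*} [CStarAlgebra 𝓐] [PartialOrder 𝓐] [StarOrderedRing 𝓐]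

/-! Solutions are the strictly positive fixed points of `f x = q + z* x⁻ᵖ z`. Since `x ≤ t • y` with
`t ≥ 1` gives `f y ≤ t ^ p • f x` (`conjRpowMap_le_smul`), `f` shrinks the Thompson distance, the
least `log t` with `x ≤ t • y` and `y ≤ t • x`, by the factor `p < 1`. This gives uniqueness, and a
fixed point in every nonempty compact invariant set of strictly positive elements.

For the error bound, the set is the self-adjoint part of the closed ball of radius `δ = θ‖R‖` about
`Y`. Write `l` for `λ_min(Y)` and `ν` for `‖Y^{-p/2} A‖`. The ball is invariant if `‖R‖ + ν² δ/(l -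
δ) ≤ δ`, a quadratic inequality in `δ` that follows from `δ² - θ₁ δ + l‖R‖ = 0` and `1 ≤ l‖Y⁻¹‖`. -/

theorem _root_.IsStrictlyPositive.real_smul {a : 𝓐} (ha : IsStrictlyPositive a) {t : ℝ}
    (ht : 0 < t) : IsStrictlyPositive (t • a) :=
  IsStrictlyPositive.iff_of_unital.2 ⟨smul_nonneg ht.le ha.nonneg,
    ha.isUnit.smul (Units.mk0 t ht.ne')⟩

theorem smul_rpow {a : 𝓐} (ha : IsStrictlyPositive a) {t : ℝ} (ht : 0 < t) (s : ℝ) :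
    (t • a) ^ s = t ^ s • a ^ s := by
  have h0 : 0 ∉ spectrum ℝ≥0 a := spectrum.zero_notMem _ ha.isUnit
  have hc : ContinuousOn (fun x : ℝ≥0 => x ^ s) (spectrum ℝ≥0 a) := fun x hx =>
    (NNReal.continuousAt_rpow_const (Or.inl fun h => h0 (h ▸ hx))).continuousWithinAt
  lift t to ℝ≥0 using ht.le
  have hta : ((t : ℝ) • a) = t • a := rfl
  rw [hta, CFC.rpow_def, CFC.rpow_def, ← NNReal.coe_rpow]
  change _ = (t ^ s) • cfc (fun x : ℝ≥0 => x ^ s) a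
  rw [← cfc_smul (t ^ s) (fun x : ℝ≥0 => x ^ s) a hc, ← cfc_comp_smul t (fun x : ℝ≥0 => x ^ s) a]
  simp [NNReal.mul_rpow]

/-- Löwner–Heinz for the exponent `p ≤ 1`, followed by antitonicity of inversion. -/
theorem rpow_neg_le_rpow_neg {p : ℝ} (hp : p ∈ Ioc 0 1) {a b : 𝓐} (ha : IsStrictlyPositive a)
    (hab : a ≤ b) : b ^ (-p) ≤ a ^ (-p) := by
  have hb : IsStrictlyPositive b := ha.of_le hab
  have h := rpow_neg_one_le_rpow_neg_one (CFC.rpow_le_rpow ⟨hp.1.le, hp.2⟩ hab)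
    (IsStrictlyPositive.rpow a p ha)
  rwa [CFC.rpow_rpow _ _ _ hp.1.ne', CFC.rpow_rpow _ _ _ hp.1.ne', mul_neg_one] at h

theorem rpow_neg_le_smul_rpow_neg {p : ℝ} (hp : p ∈ Ioc 0 1) {a b : 𝓐}
    (ha : IsStrictlyPositive a) (hb : IsStrictlyPositive b) {t : ℝ} (ht : 0 < t)
    (hab : a ≤ t • b) : b ^ (-p) ≤ t ^ p • a ^ (-p) := by
  have h := rpow_neg_le_rpow_neg hp ha hab
  rw [smul_rpow hb ht] at h
  have h2 := smul_le_smul_of_nonneg_left h (Real.rpow_nonneg ht.le p)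
  rwa [smul_smul, ← Real.rpow_add ht, add_neg_cancel, Real.rpow_zero, one_smul] at h2

theorem continuousOn_rpow_const (s : ℝ) :
    ContinuousOn (fun a : 𝓐 => a ^ s) {a | IsStrictlyPositive a} := by
  refine ContinuousOn.cfc_nnreal_of_mem_nhdsSet (s := Ioi 0) (fun x : ℝ≥0 => x ^ s) ?_
    continuousOn_id (fun a ha => ha.nonneg) ?_
  · refine (isOpen_Ioi.mem_nhdsSet).2 (iUnion₂_subset fun a ha x hx => ?_)
    refine mem_Ioi.2 (pos_iff_ne_zero.2 ?_)
    rintro rfl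
    exact spectrum.zero_notMem _ (IsStrictlyPositive.isUnit ha) hx
  · exact fun x hx =>
      (NNReal.continuousAt_rpow_const (Or.inl (ne_of_gt hx))).continuousWithinAt

theorem norm_le_of_mem_Icc_algebraMap {a : 𝓐} {r : ℝ} (ha : IsSelfAdjoint a) (hr : 0 ≤ r)
    (h₁ : a ≤ algebraMap ℝ 𝓐 r) (h₂ : algebraMap ℝ 𝓐 (-r) ≤ a) : ‖a‖ ≤ r := by
  obtain (_ | _) := subsingleton_or_nontrivial 𝓐
  · simpa [Subsingleton.elim a 0] using hr
  · obtain h | h := norm_or_neg_norm_mem_spectrum ha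
    · exact (le_algebraMap_iff_spectrum_le ha).1 h₁ _ h
    · linarith [(algebraMap_le_iff_le_spectrum ha).1 h₂ _ h]

/-- Says that Thompson distances are finite: `a` lies below its norm and `b` above a positive
scalar. -/
theorem exists_one_le_le_smul {a b : 𝓐} (ha : IsStrictlyPositive a) (hb : IsStrictlyPositive b) :
    ∃ t : ℝ, 1 ≤ t ∧ a ≤ t • b := by
  obtain (_ | _) := subsingleton_or_nontrivial 𝓐
  · exact ⟨1, le_rfl, (Subsingleton.elim _ _).le⟩
  obtain ⟨r, hr, hrb⟩ := (CFC.exists_pos_algebraMap_le_iff (a := b) hb.isSelfAdjoint).2 fun x hx =>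
    lt_of_le_of_ne (spectrum_nonneg_of_nonneg hb.nonneg hx) fun h =>
      spectrum.zero_notMem _ hb.isUnit (h ▸ hx)
  refine ⟨max 1 (‖a‖ / r), le_max_left _ _, ?_⟩
  calc a ≤ algebraMap ℝ 𝓐 ‖a‖ := ha.isSelfAdjoint.le_algebraMap_norm_self
    _ = (‖a‖ / r) • algebraMap ℝ 𝓐 r := by
      rw [Algebra.algebraMap_eq_smul_one, Algebra.algebraMap_eq_smul_one, smul_smul,
        div_mul_cancel₀ _ hr.ne']
    _ ≤ (‖a‖ / r) • b := smul_le_smul_of_nonneg_left hrb (by positivity)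
    _ ≤ max 1 (‖a‖ / r) • b := smul_le_smul_of_nonneg_right (le_max_right _ _) hb.nonneg

/-- The map `x ↦ q + z* x⁻ᵖ z`, whose fixed points solve `x - z* x⁻ᵖ z = q`. -/
noncomputable def conjRpowMap (p : ℝ) (z q x : 𝓐) : 𝓐 := q + star z * x ^ (-p) * z

variable {p : ℝ} {z q : 𝓐}

theorem isSelfAdjoint_conjRpowMap (hq : 0 ≤ q) (x : 𝓐) :
    IsSelfAdjoint (conjRpowMap p z q x) :=
  (add_nonneg hq (star_left_conjugate_nonneg CFC.rpow_nonneg z)).isSelfAdjoint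

theorem continuousOn_conjRpowMap :
    ContinuousOn (conjRpowMap p z q) {a | IsStrictlyPositive a} :=
  continuousOn_const.add ((continuousOn_const.mul (continuousOn_rpow_const _)).mul
    continuousOn_const)

/-- The contraction estimate. The conjugated term scales by `t ^ p`, and the constant `q` is
absorbed because `1 ≤ t ^ p`. -/
theorem conjRpowMap_le_smul (hp : p ∈ Ioc 0 1) (hq : 0 ≤ q) {x y : 𝓐}
    (hx : IsStrictlyPositive x) (hy : IsStrictlyPositive y) {t : ℝ} (ht : 1 ≤ t)
    (hxy : x ≤ t • y) : conjRpowMap p z q y ≤ t ^ p • conjRpowMap p z q x := by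
  have ht0 : 0 < t := zero_lt_one.trans_le ht
  unfold conjRpowMap
  rw [smul_add]
  refine add_le_add ?_ ?_
  · simpa using smul_le_smul_of_nonneg_right (Real.one_le_rpow ht hp.1.le) hq
  · refine (star_left_conjugate_le_conjugate (rpow_neg_le_smul_rpow_neg hp hx hy ht0 hxy) z).trans
      (le_of_eq ?_)
    simp

theorem eq_of_conjRpowMap_eq (hp : p ∈ Ioo 0 1) (hq : 0 ≤ q) {x y : 𝓐}
    (hx : IsStrictlyPositive x) (hy : IsStrictlyPositive y)
    (hfx : conjRpowMap p z q x = x) (hfy : conjRpowMap p z q y = y) : x = y := by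
  have key : ∀ t : ℝ, 1 ≤ t → x ≤ t • y → y ≤ t • x → x ≤ y ∧ y ≤ x := by
    intro t ht h₁ h₂
    have ht0 : 0 < t := zero_lt_one.trans_le ht
    -- Each application of `f` swaps the two inequalities and raises the factor to the power `p`;
    -- the factors tend to `1`.
    have hk : ∀ k : ℕ, x ≤ t ^ (p ^ k) • y ∧ y ≤ t ^ (p ^ k) • x := by
      intro k
      induction k with
      | zero => simpa using ⟨h₁, h₂⟩
      | succ k ih =>
        have h1 : (1 : ℝ) ≤ t ^ (p ^ k) := Real.one_le_rpow ht (_root_.pow_nonneg hp.1.le k)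
        have e : (t ^ (p ^ k)) ^ p = t ^ (p ^ (k + 1)) := by
          rw [← Real.rpow_mul ht0.le, pow_succ]
        have a₁ := conjRpowMap_le_smul (z := z) ⟨hp.1, hp.2.le⟩ hq hy hx h1 ih.2
        have a₂ := conjRpowMap_le_smul (z := z) ⟨hp.1, hp.2.le⟩ hq hx hy h1 ih.1
        rw [hfx, hfy, e] at a₁ a₂
        exact ⟨a₁, a₂⟩
    have hlim : Tendsto (fun k : ℕ => t ^ (p ^ k)) atTop (𝓝 1) := by
      simpa using tendsto_const_nhds (x := t) |>.rpow
        (tendsto_pow_atTop_nhds_zero_of_lt_one hp.1.le hp.2) (Or.inl ht0.ne')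
    constructor
    · simpa using ge_of_tendsto' (hlim.smul_const y) fun k => (hk k).1
    · simpa using ge_of_tendsto' (hlim.smul_const x) fun k => (hk k).2
  obtain ⟨t, ht, hxy⟩ := exists_one_le_le_smul hx hy
  obtain ⟨s, hs, hyx⟩ := exists_one_le_le_smul hy hx
  obtain ⟨h₁, h₂⟩ := key (max t s) (ht.trans (le_max_left _ _))
    (hxy.trans (smul_le_smul_of_nonneg_right (le_max_left _ _) hy.nonneg))
    (hyx.trans (smul_le_smul_of_nonneg_right (le_max_right _ _) hx.nonneg))
  exact le_antisymm h₁ h₂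

/-- A compact set of strictly positive elements that is invariant under `conjRpowMap` contains a
fixed point: a point at which the Thompson distance to the image is minimal. -/
theorem exists_conjRpowMap_eq (hp : p ∈ Ioo 0 1) (hq : 0 ≤ q) {K : Set 𝓐} (hK : IsCompact K)
    (hne : K.Nonempty) (hpos : ∀ x ∈ K, IsStrictlyPositive x)
    (hmaps : MapsTo (conjRpowMap p z q) K K) : ∃ x ∈ K, conjRpowMap p z q x = x := by
  set f := conjRpowMap p z q with hf
  have hfc : ContinuousOn f K := continuousOn_conjRpowMap.mono hpos
  obtain ⟨x₀, hx₀⟩ := hne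
  obtain ⟨t, ht, h₁⟩ := exists_one_le_le_smul (hpos _ hx₀) (hpos _ (hmaps hx₀))
  obtain ⟨s, hs, h₂⟩ := exists_one_le_le_smul (hpos _ (hmaps hx₀)) (hpos _ hx₀)
  set T := max t s
  set B : Set (𝓐 × ℝ) := K ×ˢ Icc 1 T
  have hB : IsCompact B := hK.prod isCompact_Icc
  have c₁ : ContinuousOn (fun u : 𝓐 × ℝ => f u.1) B :=
    hfc.comp continuousOn_fst fun u hu => hu.1
  set S : Set (𝓐 × ℝ) := {u ∈ B | u.1 ≤ u.2 • f u.1 ∧ f u.1 ≤ u.2 • u.1}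
  have hS : IsCompact S := by
    have e₁ : IsClosed {u ∈ B | u.1 ≤ u.2 • f u.1} :=
      hB.isClosed.isClosed_le continuousOn_fst (continuousOn_snd.smul c₁)
    have e₂ : IsClosed {u ∈ B | f u.1 ≤ u.2 • u.1} :=
      hB.isClosed.isClosed_le c₁ (continuousOn_snd.smul continuousOn_fst)
    refine hB.of_isClosed_subset (t := S) ?_ fun u hu => hu.1
    convert e₁.inter e₂ using 1
    ext u
    simp only [S, mem_ofPred_eq, mem_inter_iff]
    tauto
  have hSne : S.Nonempty := ⟨(x₀, T), ⟨hx₀, ht.trans (le_max_left _ _), le_rfl⟩,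
    h₁.trans (smul_le_smul_of_nonneg_right (le_max_left _ _) (hpos _ (hmaps hx₀)).nonneg),
    h₂.trans (smul_le_smul_of_nonneg_right (le_max_right _ _) (hpos _ hx₀).nonneg)⟩
  obtain ⟨⟨x, r⟩, ⟨⟨hxK, hr1, hrT⟩, hx₁, hx₂⟩, hmin⟩ := hS.exists_isMinOn hSne continuousOn_snd
  simp only at hxK hr1 hrT hx₁ hx₂
  have hx := hpos x hxK
  have hfx := hpos _ (hmaps hxK)
  have hp' : p ∈ Ioc 0 1 := ⟨hp.1, hp.2.le⟩
  have hrp : r ^ p ≤ r := by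
    simpa using Real.rpow_le_rpow_of_exponent_le hr1 hp.2.le
  -- Passing from `x` to `f x` improves the factor `r` to `r ^ p`, so minimality of `r` forces `r =
  -- 1`.
  have hmem : (f x, r ^ p) ∈ S :=
    ⟨⟨hmaps hxK, Real.one_le_rpow hr1 hp.1.le, hrp.trans hrT⟩,
      conjRpowMap_le_smul hp' hq hfx hx hr1 hx₂, conjRpowMap_le_smul hp' hq hx hfx hr1 hx₁⟩
  have hle : r ≤ r ^ p := hmin hmem
  have hr : r = 1 := by
    by_contra h
    have h1 : 1 < r := lt_of_le_of_ne hr1 (Ne.symm h)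
    have := Real.rpow_lt_rpow_of_exponent_lt h1 hp.2
    rw [Real.rpow_one] at this
    linarith
  rw [hr, one_smul] at hx₁ hx₂
  exact ⟨x, hxK, le_antisymm hx₂ hx₁⟩

/-- As `p ≤ 1`, the bounds `(1 - ε)⁻ᵖ ≤ (1 - ε)⁻¹ = 1 + c` and `(1 + ε)⁻ᵖ ≥ (1 + ε)⁻¹ ≥ 1 - c`, with
`c = ε / (1 - ε)`, trap `x⁻ᵖ - y⁻ᵖ` between `± c • y⁻ᵖ`. Conjugating by `z` turns `y⁻ᵖ` into `w* w`
with `w = y^{-p/2} z`. -/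
theorem norm_conjugate_rpow_neg_sub_le (hp : p ∈ Ioc 0 1) {x y : 𝓐} (hy : IsStrictlyPositive y)
    {ε : ℝ} (hε0 : 0 ≤ ε) (hε1 : ε < 1) (h₁ : (1 - ε) • y ≤ x) (h₂ : x ≤ (1 + ε) • y) (z : 𝓐) :
    ‖star z * (x ^ (-p) - y ^ (-p)) * z‖ ≤ ‖y ^ (-(p / 2)) * z‖ ^ 2 * (ε / (1 - ε)) := by
  have hε : 0 < 1 - ε := by linarith
  have hx : IsStrictlyPositive x := (hy.real_smul hε).of_le h₁
  set c := ε / (1 - ε) with hc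
  have hc0 : 0 ≤ c := by positivity
  have hyp : (0 : 𝓐) ≤ y ^ (-p) := CFC.rpow_nonneg
  have u₁ : x ^ (-p) - y ^ (-p) ≤ c • y ^ (-p) := by
    have h := rpow_neg_le_smul_rpow_neg hp hy hx (t := (1 - ε)⁻¹) (by positivity) (by
      have := smul_le_smul_of_nonneg_left h₁ (inv_nonneg.2 hε.le)
      rwa [smul_smul, inv_mul_cancel₀ hε.ne', one_smul] at this)
    have hb : ((1 - ε)⁻¹) ^ p ≤ 1 + c := by
      have h1 : (1 : ℝ) ≤ (1 - ε)⁻¹ := (one_le_inv₀ hε).2 (by linarith)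
      calc ((1 - ε)⁻¹) ^ p ≤ ((1 - ε)⁻¹) ^ (1 : ℝ) := Real.rpow_le_rpow_of_exponent_le h1 hp.2
        _ = 1 + c := by rw [Real.rpow_one, hc]; field_simp; ring
    have h' := h.trans (smul_le_smul_of_nonneg_right hb hyp)
    rw [add_smul, one_smul] at h'
    exact sub_le_iff_le_add'.2 h'
  have u₂ : (-c) • y ^ (-p) ≤ x ^ (-p) - y ^ (-p) := by
    have h := rpow_neg_le_rpow_neg hp hx h₂
    rw [smul_rpow hy (by linarith)] at h
    have hb : 1 - c ≤ (1 + ε) ^ (-p) := by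
      have h1 : (1 : ℝ) ≤ 1 + ε := by linarith
      calc 1 - c ≤ (1 + ε) ^ (-1 : ℝ) := by
            rw [Real.rpow_neg_one, hc, ← one_div, le_div_iff₀ (by linarith)]
            have : ε / (1 - ε) * (1 + ε) ≥ ε := by
              rw [ge_iff_le, div_mul_eq_mul_div, le_div_iff₀ hε]
              nlinarith
            linarith
        _ ≤ (1 + ε) ^ (-p) := Real.rpow_le_rpow_of_exponent_le h1 (neg_le_neg hp.2)
    have h' := (smul_le_smul_of_nonneg_right hb hyp).trans h
    rw [sub_smul, one_smul] at h'
    rw [neg_smul, neg_le_sub_iff_le_add, ← sub_le_iff_le_add]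
    exact h'
  have hW : star z * y ^ (-p) * z ≤ algebraMap ℝ 𝓐 (‖y ^ (-(p / 2)) * z‖ ^ 2) := by
    refine le_trans (le_of_eq ?_) (star_mul_le_algebraMap_norm_sq (a := y ^ (-(p / 2)) * z))
    have hs : star (y ^ (-(p / 2))) = y ^ (-(p / 2)) :=
      (CFC.rpow_nonneg (a := y)).isSelfAdjoint.star_eq
    have hm : y ^ (-(p / 2)) * y ^ (-(p / 2)) = y ^ (-p) := by
      rw [← CFC.rpow_add hy.isUnit]
      ring_nf
    rw [star_mul, hs, ← hm]
    simp only [mul_assoc]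
  have hcW : c • (star z * y ^ (-p) * z) ≤
      algebraMap ℝ 𝓐 (‖y ^ (-(p / 2)) * z‖ ^ 2 * c) := by
    refine (smul_le_smul_of_nonneg_left hW hc0).trans (le_of_eq ?_)
    rw [Algebra.algebraMap_eq_smul_one, Algebra.algebraMap_eq_smul_one, smul_smul, mul_comm]
  have hsa : IsSelfAdjoint (star z * (x ^ (-p) - y ^ (-p)) * z) :=
    (((CFC.rpow_nonneg (a := x)).isSelfAdjoint).sub hyp.isSelfAdjoint).conjugate' z
  refine norm_le_of_mem_Icc_algebraMap hsa (by positivity) ?_ ?_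
  · refine (star_left_conjugate_le_conjugate u₁ z).trans (le_trans (le_of_eq ?_) hcW)
    simp
  · refine le_trans ?_ (star_left_conjugate_le_conjugate u₂ z)
    rw [map_neg]
    refine (neg_le_neg hcW).trans (le_of_eq ?_)
    simp

/-- If `y` is an approximate fixed point of `conjRpowMap`, then there is a fixed point close
to `y`. -/
theorem exists_conjRpowMap_eq_of_norm_sub_le [ProperSpace 𝓐] (hp : p ∈ Ioo 0 1) (hq : 0 ≤ q)
    {y : 𝓐} (hy : IsStrictlyPositive y) {l δ : ℝ} (hly : algebraMap ℝ 𝓐 l ≤ y) (hδ0 : 0 ≤ δ)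
    (hδl : δ < l)
    (hball : ‖conjRpowMap p z q y - y‖ + ‖y ^ (-(p / 2)) * z‖ ^ 2 * (δ / (l - δ)) ≤ δ) :
    ∃ x, IsStrictlyPositive x ∧ conjRpowMap p z q x = x ∧ ‖y - x‖ ≤ δ := by
  have hl : 0 < l := hδ0.trans_lt hδl
  set ε := δ / l
  have hε0 : 0 ≤ ε := by positivity
  have hε1 : ε < 1 := (div_lt_one hl).2 hδl
  set K : Set 𝓐 := Metric.closedBall y δ ∩ {x | IsSelfAdjoint x}
  -- The additive error `δ` becomes the relative error `ε = δ / l`, because `l ≤ y`.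
  have hbd : ∀ x ∈ K, (1 - ε) • y ≤ x ∧ x ≤ (1 + ε) • y := by
    rintro x ⟨hx, hsa⟩
    rw [mem_closedBall_iff_norm] at hx
    have hδy : algebraMap ℝ 𝓐 δ ≤ ε • y := by
      refine le_trans (le_of_eq ?_) (smul_le_smul_of_nonneg_left hly hε0)
      rw [Algebra.algebraMap_eq_smul_one, Algebra.algebraMap_eq_smul_one, smul_smul,
        div_mul_cancel₀ _ hl.ne']
    have hd : IsSelfAdjoint (x - y) := hsa.sub hy.isSelfAdjoint
    have hm : algebraMap ℝ 𝓐 ‖x - y‖ ≤ ε • y := (algebraMap_mono 𝓐 hx).trans hδy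
    have h₁ := hd.le_algebraMap_norm_self.trans hm
    have h₂ := (neg_le_neg hm).trans hd.neg_algebraMap_norm_le_self
    rw [sub_smul, add_smul, one_smul]
    exact ⟨by rw [sub_eq_add_neg]; exact le_sub_iff_add_le'.1 h₂, sub_le_iff_le_add'.1 h₁⟩
  have hpos : ∀ x ∈ K, IsStrictlyPositive x := fun x hx =>
    (hy.real_smul (by linarith)).of_le (hbd x hx).1
  have hK : IsCompact K := (isCompact_closedBall y δ).inter_right
    (isClosed_eq continuous_star continuous_id)
  have hmaps : MapsTo (conjRpowMap p z q) K K := by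
    intro x hx
    refine ⟨?_, isSelfAdjoint_conjRpowMap hq x⟩
    rw [mem_closedBall_iff_norm]
    have hn := norm_conjugate_rpow_neg_sub_le ⟨hp.1, hp.2.le⟩ hy hε0 hε1
      (hbd x hx).1 (hbd x hx).2 z
    have he : ε / (1 - ε) = δ / (l - δ) := by
      have : l - δ ≠ 0 := by linarith
      have : 1 - ε ≠ 0 := by linarith
      simp only [ε] at *
      field_simp
    rw [he] at hn
    have hsplit : conjRpowMap p z q x - y =
        (conjRpowMap p z q y - y) + star z * (x ^ (-p) - y ^ (-p)) * z := by
      unfold conjRpowMap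
      noncomm_ring
    rw [hsplit]
    exact (norm_add_le _ _).trans (by linarith)
  obtain ⟨x, hxK, hfx⟩ := exists_conjRpowMap_eq hp hq hK
    ⟨y, Metric.mem_closedBall_self hδ0, hy.isSelfAdjoint⟩ hpos hmaps
  refine ⟨x, hpos x hxK, hfx, ?_⟩
  rw [norm_sub_rev]
  exact mem_closedBall_iff_norm.1 hxK.1

end CStarAlgebra

/-! ### The smallest eigenvalue and the matrix equation -/

namespace MatrixEq

section lambdaMin

variable {n : ℕ} [NeZero n] {M : Matrix (Fin n) (Fin n) ℂ}

theorem lambdaMin_mem_spectrum (hM : M.IsHermitian) : lambdaMin M ∈ spectrum ℝ M := by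
  rw [hM.spectrum_real_eq_range_eigenvalues]
  exact (isLeast_lambdaMin hM).1

theorem algebraMap_lambdaMin_le (hM : M.IsHermitian) :
    algebraMap ℝ (Matrix (Fin n) (Fin n) ℂ) (lambdaMin M) ≤ M := by
  refine algebraMap_le_of_le_spectrum (fun x hx => ?_) hM.isSelfAdjoint
  rw [hM.spectrum_real_eq_range_eigenvalues] at hx
  exact (isLeast_lambdaMin hM).2 hx

theorem lambdaMin_pos (hM : M.PosDef) : 0 < lambdaMin M := by
  obtain ⟨i, hi⟩ := (isLeast_lambdaMin hM.isHermitian).1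
  exact hi ▸ hM.eigenvalues_pos i

theorem one_le_lambdaMin_mul_norm_inv (hM : M.PosDef) : 1 ≤ lambdaMin M * ‖M⁻¹‖ := by
  have hl := lambdaMin_pos hM
  have hu : IsUnit M := hM.isUnit
  have hmem : (lambdaMin M)⁻¹ ∈ spectrum ℝ M⁻¹ := by
    obtain ⟨u, rfl⟩ := hu
    rw [← Matrix.coe_units_inv]
    exact spectrum.inv_mem_iff (r := Units.mk0 _ hl.ne') |>.1
      (lambdaMin_mem_spectrum hM.isHermitian)
  have h := spectrum.norm_le_norm_of_mem hmem
  rw [Real.norm_of_nonneg (inv_nonneg.2 hl.le)] at h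
  calc 1 = lambdaMin M * (lambdaMin M)⁻¹ := (mul_inv_cancel₀ hl.ne').symm
    _ ≤ _ := by gcongr

end lambdaMin

theorem isPosDefSolution_iff {n : ℕ} {p : ℝ} {A Q X : Matrix (Fin n) (Fin n) ℂ} :
    IsPosDefSolution p A Q X ↔
      IsStrictlyPositive X ∧ CStarAlgebra.conjRpowMap p A Q X = X := by
  rw [IsPosDefSolution, Matrix.isStrictlyPositive_iff_posDef]
  refine and_congr_right fun _ => ?_
  rw [sub_eq_iff_eq_add, eq_comm]
  rfl

theorem residual_eq {n : ℕ} (p : ℝ) (A Q Y : Matrix (Fin n) (Fin n) ℂ) :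
    residual p A Q Y = CStarAlgebra.conjRpowMap p A Q Y - Y := rfl

/-- With `θ₁ = (1 - m) l + r`, the number `δ = 2 l r / (θ₁ + √(θ₁² - 4 l r))` is the smaller root
of `δ² - θ₁ δ + l r = 0` and lies in the interval `[0, (1 - m) l]`. -/
theorem smaller_root_spec {l r m t : ℝ} (hl : 0 < l) (hr : 0 ≤ r) (hm : m < 1)
    (ht : t = (1 - m) * l + r) (h : r ≤ t / 2 * min 1 (t / (2 * l))) :
    let δ := 2 * l / (t + √(t ^ 2 - 4 * l * r)) * r
    0 ≤ δ ∧ δ ≤ (1 - m) * l ∧ δ ^ 2 - t * δ + l * r = 0 := by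
  intro δ
  have hml : 0 < (1 - m) * l := mul_pos (by linarith) hl
  have ht0 : 0 < t := by linarith
  -- The first entry of the minimum yields `δ ≤ t / 2 ≤ t - r = (1 - m) * l`; the second makes the
  -- discriminant nonnegative.
  have h₁ : r ≤ t / 2 := h.trans (mul_le_of_le_one_right (by positivity) (min_le_left _ _))
  have h₂ : 4 * l * r ≤ t ^ 2 := by
    have := h.trans (mul_le_mul_of_nonneg_left (min_le_right _ _) (by positivity))
    rw [div_mul_div_comm, le_div_iff₀ (by positivity)] at this
    linarith
  set s := √(t ^ 2 - 4 * l * r) with hs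
  have hs0 : 0 ≤ s := Real.sqrt_nonneg _
  have hs2 : s ^ 2 = t ^ 2 - 4 * l * r := Real.sq_sqrt (by linarith)
  have hδ : δ = (t - s) / 2 := by
    have : t + s ≠ 0 := by positivity
    change 2 * l / (t + s) * r = (t - s) / 2
    field_simp
    linear_combination hs2
  refine ⟨by positivity, by linarith, ?_⟩
  rw [hδ]
  linear_combination hs2 / 4

theorem exists_isPosDefSolution_norm_sub_le {n : ℕ} [NeZero n] {p : ℝ} (hp0 : 0 < p) (hp1 : p < 1)
    {A Q Y : Matrix (Fin n) (Fin n) ℂ} (hQ : Q.PosDef) (hY : Y.PosDef)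
    (hA : ‖Y ^ (-(p / 2)) * A‖ ^ 2 * ‖Y⁻¹‖ < 1)
    (hR : ‖residual p A Q Y‖ ≤ theta₁ p A Q Y / 2 * min 1 (theta₁ p A Q Y / (2 * lambdaMin Y))) :
    ∃ X, IsPosDefSolution p A Q X ∧ ‖Y - X‖ ≤ theta p A Q Y * ‖residual p A Q Y‖ := by
  have hl := lambdaMin_pos hY
  have hN := one_le_lambdaMin_mul_norm_inv hY
  have hYs : IsStrictlyPositive Y := Matrix.isStrictlyPositive_iff_posDef.2 hY
  obtain ⟨hδ0, hδl, hδ⟩ := smaller_root_spec hl (norm_nonneg _) hA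
    (rfl : theta₁ p A Q Y = _) hR
  change 0 ≤ theta p A Q Y * ‖residual p A Q Y‖ at hδ0
  change theta p A Q Y * ‖residual p A Q Y‖ ≤ _ at hδl
  change (theta p A Q Y * ‖residual p A Q Y‖) ^ 2 -
    theta₁ p A Q Y * (theta p A Q Y * ‖residual p A Q Y‖) + _ = 0 at hδ
  rw [theta₁] at hδ
  generalize theta p A Q Y * ‖residual p A Q Y‖ = δ at *
  -- For `A = 0` the radius `δ` may equal `l`, where `δ / (l - δ)` is useless; but then `Q` is a
  -- solution and the quadratic factors as `(δ - l)(δ - ‖R‖)`. For `A ≠ 0`, `ν > 0` makes `δ < l`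
  -- strict.
  rcases eq_or_ne A 0 with rfl | hA0
  · refine ⟨Q, ⟨hQ, by simp⟩, ?_⟩
    simp only [residual, Matrix.mul_zero, add_zero, norm_zero, ne_eq, OfNat.ofNat_ne_zero,
      not_false_eq_true, zero_pow, zero_mul, sub_zero, one_mul] at hδ hδl
    rw [norm_sub_rev]
    have h : (δ - lambdaMin Y) * (δ - ‖Q - Y‖) = 0 := by linear_combination hδ
    have hr : ‖Q - Y‖ ≤ lambdaMin Y := by
      have := hR.trans (mul_le_of_le_one_right ?_ (min_le_left _ _))
      · simp only [residual, theta₁, Matrix.mul_zero, add_zero, norm_zero, ne_eq,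
          OfNat.ofNat_ne_zero, not_false_eq_true, zero_pow, zero_mul, sub_zero, one_mul] at this
        linarith
      · rw [theta₁]
        simp only [Matrix.mul_zero, norm_zero, ne_eq,
          OfNat.ofNat_ne_zero, not_false_eq_true, zero_pow, zero_mul, sub_zero, one_mul]
        positivity
    rcases mul_eq_zero.1 h with h | h <;> linarith
  · have hν : 0 < ‖Y ^ (-(p / 2)) * A‖ := by
      refine norm_pos_iff.2 fun h => hA0 ?_
      have hu : IsUnit (Y ^ (-(p / 2))) := hYs.isUnit.cfcRpow _ hYs.nonneg
      exact hu.mul_right_eq_zero.1 h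
    have hN0 : 0 < ‖Y⁻¹‖ := by
      by_contra h0
      nlinarith [norm_nonneg Y⁻¹]
    have hlt : δ < lambdaMin Y := by
      have : 0 < ‖Y ^ (-(p / 2)) * A‖ ^ 2 * ‖Y⁻¹‖ := by positivity
      nlinarith
    have : ProperSpace (Matrix (Fin n) (Fin n) ℂ) := FiniteDimensional.proper ℂ _
    obtain ⟨X, hX, hfX, hd⟩ := CStarAlgebra.exists_conjRpowMap_eq_of_norm_sub_le (z := A) (q := Q)
      ⟨hp0, hp1⟩ hQ.posSemidef.nonneg hYs (algebraMap_lambdaMin_le hY.isHermitian) hδ0 hlt (by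
        rw [← residual_eq, ← sub_nonneg]
        have hpos : 0 < lambdaMin Y - δ := by linarith
        -- The quadratic for `δ`, with `ν² l‖Y⁻¹‖` in its linear coefficient weakened to `ν²`.
        have hkey : ‖residual p A Q Y‖ * (lambdaMin Y - δ) + ‖Y ^ (-(p / 2)) * A‖ ^ 2 * δ ≤
            δ * (lambdaMin Y - δ) := by
          have := mul_le_mul_of_nonneg_left hN
            (mul_nonneg (sq_nonneg ‖Y ^ (-(p / 2)) * A‖) hδ0)
          linarith
        have e : δ - (‖residual p A Q Y‖ + ‖Y ^ (-(p / 2)) * A‖ ^ 2 * (δ / (lambdaMin Y - δ))) =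
            (δ * (lambdaMin Y - δ) - (‖residual p A Q Y‖ * (lambdaMin Y - δ) +
              ‖Y ^ (-(p / 2)) * A‖ ^ 2 * δ)) / (lambdaMin Y - δ) := by
          field_simp
        rw [e]
        exact div_nonneg (by linarith) hpos.le)
    exact ⟨X, isPosDefSolution_iff.2 ⟨hX, hfX⟩, hd⟩

end MatrixEq

theorem theorem7p1 {n : ℕ} [NeZero n] (p : ℝ) (hp0 : 0 < p) (hp1 : p < 1)
    (A Q Xt : Matrix (Fin n) (Fin n) ℂ) (hQ : Q.PosDef) (hXt : Xt.PosDef)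
    (hA : ‖Xt ^ (-(p / 2)) * A‖ ^ 2 * ‖Xt⁻¹‖ < 1)
    (hR : ‖MatrixEq.residual p A Q Xt‖ ≤
      MatrixEq.theta₁ p A Q Xt / 2 *
        min 1 (MatrixEq.theta₁ p A Q Xt / (2 * MatrixEq.lambdaMin Xt))) :
    (∃! X : Matrix (Fin n) (Fin n) ℂ, MatrixEq.IsPosDefSolution p A Q X) ∧
    ∀ X : Matrix (Fin n) (Fin n) ℂ, MatrixEq.IsPosDefSolution p A Q X →
      ‖Xt - X‖ ≤ MatrixEq.theta p A Q Xt * ‖MatrixEq.residual p A Q Xt‖ := by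
  obtain ⟨X, hX, hd⟩ :=
    MatrixEq.exists_isPosDefSolution_norm_sub_le hp0 hp1 hQ hXt hA hR
  have huniq : ∀ Z, MatrixEq.IsPosDefSolution p A Q Z → Z = X := by
    intro Z hZ
    rw [MatrixEq.isPosDefSolution_iff] at hX hZ
    exact CStarAlgebra.eq_of_conjRpowMap_eq (z := A) (q := Q) ⟨hp0, hp1⟩ hQ.posSemidef.nonneg
      hZ.1 hX.1 hZ.2 hX.2
  exact ⟨⟨X, hX, huniq⟩, fun Z hZ => huniq Z hZ ▸ hd⟩
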